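/- Let $D\subset\mathbb R^d$, $d\ge 1$, be a nonempty bounded open set (for instance a bounded Lipschitz domain), and let $Y=H^1_0(D)$ be the closure of $C_c^\infty(D)$ in $H^1(D)$, normed by $\|y\|_Y=\|\nabla y\|_{L^2(D)}$, with topological dual $Y^\star$ and Riesz isomorphism $\Lambda_Y:Y\to Y^\star$, $\langle\Lambda_Y u,v\rangle=(u,v)_Y$. Let $(\Omega,\mathcal F,\mathbb P)$ be a probability space and let $\kappa:\Omega\to C^0(\overline D)$ be a measurable map with $\mathbb P$-almost surely positive values $\kappa(\cdot,\omega)$. Put $\kappa_{\min}(\omega)=\min_{\overline D}\kappa(\cdot,\omega)$ and $\kappa_{\max}(\omega)=\max_{\overline D}\kappa(\cdot,\omega)$, and assume that $\kappa_{\max}$ and $1/\kappa_{\min}$ belong to $L^p(\Omega)$ for some $p\in[1,\infty]$. For $u,v:\Omega\to Y$ let $$a(u,v)=\int_\Omega\int_D\kappa(x,\omega)\,\nabla u(x,\omega)\cdot\nabla v(x,\omega)\,dx\,d\mathbb P(\omega),$$ and let $V$ be the energy space of ($\mathbb P$-a.s. equivalence classes of) measurable functions $v:\Omega\to Y$ with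 $\|v\|_{\mathcal A}^2:=a(v,v)<\infty$, with norm $\|\cdot\|_{\mathcal A}$ and dual $V^\star$. Define $\mathcal A:V\to V^\star$ by $\langle\mathcal A u,v\rangle=a(u,v)$ and $\mathcal I:Y^\star\to V^\star$ by $\langle\mathcal I f,v\rangle=\mathbb E[\langle f,v_\omega\rangle]$. Let $G=\{v\in V:\mathbb E[v]=0\}$ (Bochner integral in $Y$), $G^0=\{F\in V^\star: F(v)=0\ \forall v\in G\}$ and $G^\perp=\{y\in V: a(y,v)=0\ \forall v\in G\}$. Then $\mathcal I$ is a bijection from $Y^\star$ onto $G^0$ and $\mathcal A$ maps $G^\perp$ into $G^0$, so that the map $\mathcal E^{-1}:=\Lambda_Y^{-1}\mathcal I^{-1}\mathcal A:G^\perp\to Y$ is well defined. It is a homeomorphism from $(G^\perp,\|\cdot\|_{\mathcal A})$ onto $(Y,\|\cdot\|_Y)$, and for all $y\in G^\perp$ $$\frac{1}{\sqrt{\mathbb E[1/\kappa_{\min}]}}\,\|y\|_{\mathcal A}\;\le\;\|\mathcal E^{-1}y\|_Y\;\le\;\sqrt{\mathbb E[\kappa_{\max}]}\,\|y\|_{\mathcal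 A}.$$ -/

import Mathlib

noncomputable section

namespace RobustOCP

open MeasureTheory Set Filter Topology
open scoped ENNReal

/-- A nonempty bounded open set `D ⊆ ℝ^d` (the spatial domain). No regularity of the boundary and
no connectedness is required, so bounded Lipschitz domains are included. -/
structure Domain (d : ℕ) where
  carrier : Set (EuclideanSpace ℝ (Fin d))
  isOpen : IsOpen carrier
  isBounded : Bornology.IsBounded carrier
  nonempty : carrier.Nonempty

variable {d : ℕ}

/-- Lebesgue measure on `D`. -/
abbrev Domain.vol (D : Domain d) : Measure (EuclideanSpace ℝ (Fin d)) :=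
  volume.restrict D.carrier

/-- `L²(D)`. -/
abbrev L2 (D : Domain d) : Type := Lp ℝ 2 D.vol

/-- `L²(D; ℝ^d)`. -/
abbrev L2Vec (D : Domain d) : Type := Lp (EuclideanSpace ℝ (Fin d)) 2 D.vol

/-- `φ ∈ C_c^∞(D)`. -/
def IsTestFunction (D : Domain d) (φ : EuclideanSpace ℝ (Fin d) → ℝ) : Prop :=
  ContDiff ℝ (⊤ : ℕ∞) φ ∧ HasCompactSupport φ ∧ tsupport φ ⊆ D.carrier

/-- The partial derivative `∂_i φ`. -/
def partialDeriv (i : Fin d) (φ : EuclideanSpace ℝ (Fin d) → ℝ)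
    (x : EuclideanSpace ℝ (Fin d)) : ℝ :=
  fderiv ℝ φ x (EuclideanSpace.single i 1)

/-- `g` is the weak gradient of `u` on `D`:
`∫_D u ∂_i φ = - ∫_D g_i φ` for all `i` and all `φ ∈ C_c^∞(D)`. -/
def IsWeakGradient (D : Domain d) (u : L2 D) (g : L2Vec D) : Prop :=
  ∀ φ, IsTestFunction D φ → ∀ i : Fin d,
    ∫ x in D.carrier, u x * partialDeriv i φ x = - ∫ x in D.carrier, g x i * φ x

lemma IsTestFunction.memLp {D : Domain d} {φ : EuclideanSpace ℝ (Fin d) → ℝ}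
    (hφ : IsTestFunction D φ) : MemLp φ 2 D.vol :=
  (hφ.1.continuous.memLp_of_hasCompactSupport hφ.2.1)

lemma IsTestFunction.continuous_partialDeriv {D : Domain d}
    {φ : EuclideanSpace ℝ (Fin d) → ℝ}
    (hφ : IsTestFunction D φ) (i : Fin d) : Continuous (partialDeriv i φ) :=
  (hφ.1.continuous_fderiv (by simp)).clm_apply continuous_const

lemma IsTestFunction.hasCompactSupport_partialDeriv {D : Domain d}
    {φ : EuclideanSpace ℝ (Fin d) → ℝ}
    (hφ : IsTestFunction D φ) (i : Fin d) : HasCompactSupport (partialDeriv i φ) :=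
  hφ.2.1.fderiv_apply ℝ _

lemma IsTestFunction.memLp_partialDeriv {D : Domain d} {φ : EuclideanSpace ℝ (Fin d) → ℝ}
    (hφ : IsTestFunction D φ) (i : Fin d) : MemLp (partialDeriv i φ) 2 D.vol :=
  (hφ.continuous_partialDeriv i).memLp_of_hasCompactSupport
    (hφ.hasCompactSupport_partialDeriv i)

lemma integral_mul_eq_inner {D : Domain d} {ψ : EuclideanSpace ℝ (Fin d) → ℝ}
    (hψ : MemLp ψ 2 D.vol) (u : L2 D) :
    ∫ x in D.carrier, u x * ψ x = inner ℝ (hψ.toLp ψ) u := by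
  rw [L2.inner_def]
  refine integral_congr_ae ?_
  filter_upwards [hψ.coeFn_toLp] with x hx
  rw [hx]; simp

lemma integral_coord_mul_eq_inner {D : Domain d} {ψ : EuclideanSpace ℝ (Fin d) → ℝ}
    (hψ : MemLp ψ 2 D.vol) (i : Fin d) :
    ∃ w : L2Vec D, ∀ g : L2Vec D, ∫ x in D.carrier, g x i * ψ x = inner ℝ w g := by
  have h2 : MemLp (fun x => ψ x • EuclideanSpace.single i (1 : ℝ)) 2 D.vol := by
    refine MemLp.of_le (g := ψ) hψ (hψ.1.smul_const _) (ae_of_all _ fun x => ?_)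
    rw [norm_smul]; simp
  refine ⟨h2.toLp _, fun g => ?_⟩
  rw [L2.inner_def]
  refine integral_congr_ae ?_
  filter_upwards [h2.coeFn_toLp] with x hx
  rw [hx, inner_smul_left, EuclideanSpace.inner_single_left]
  simp [mul_comm]

lemma isWeakGradient_iff {D : Domain d} {φ : EuclideanSpace ℝ (Fin d) → ℝ}
    (hφ : IsTestFunction D φ) (i : Fin d) : ∃ (a : L2 D) (w : L2Vec D),
    ∀ (u : L2 D) (g : L2Vec D),
      (∫ x in D.carrier, u x * partialDeriv i φ x = - ∫ x in D.carrier, g x i * φ x) ↔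
        inner ℝ a u + inner ℝ w g = 0 := by
  obtain ⟨w, hw⟩ := integral_coord_mul_eq_inner hφ.memLp i
  refine ⟨(hφ.memLp_partialDeriv i).toLp _, w, fun u g => ?_⟩
  · rw [hw, integral_mul_eq_inner (hφ.memLp_partialDeriv i), eq_neg_iff_add_eq_zero]

/-- `H¹(D)`, as the space of pairs `(u, ∇u) ∈ L²(D) × L²(D; ℝ^d)` of a function and its weak
gradient. The topology induced from the product is that of the `H¹`-norm. -/
def H1 (D : Domain d) : Submodule ℝ (L2 D × L2Vec D) where
  carrier := {p | IsWeakGradient D p.1 p.2}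
  zero_mem' := fun φ hφ i => by
    obtain ⟨a, w, h⟩ := isWeakGradient_iff hφ i
    rw [h]; simp
  add_mem' := fun {p q} hp hq φ hφ i => by
    obtain ⟨a, w, h⟩ := isWeakGradient_iff hφ i
    have h1 := (h _ _).1 (hp φ hφ i)
    have h2 := (h _ _).1 (hq φ hφ i)
    rw [h]; simp only [Prod.fst_add, Prod.snd_add, inner_add_right]; linarith
  smul_mem' := fun c p hp φ hφ i => by
    obtain ⟨a, w, h⟩ := isWeakGradient_iff hφ i
    have h1 := (h _ _).1 (hp φ hφ i)
    rw [h]; simp only [Prod.smul_fst, Prod.smul_snd, inner_smul_right]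
    rw [← mul_add, h1, mul_zero]

/-- The pairs `(φ, ∇φ)` with `φ ∈ C_c^∞(D)`. -/
def testPairs (D : Domain d) : Set (L2 D × L2Vec D) :=
  {p | ∃ φ, IsTestFunction D φ ∧ p.1 =ᵐ[D.vol] φ ∧ p.2 =ᵐ[D.vol] gradient φ}

lemma isClosed_H1 (D : Domain d) : IsClosed (H1 D : Set (L2 D × L2Vec D)) := by
  have : (H1 D : Set (L2 D × L2Vec D)) = ⋂ (φ) (hφ : IsTestFunction D φ) (i : Fin d),
      {p | ∫ x in D.carrier, p.1 x * partialDeriv i φ x =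
        - ∫ x in D.carrier, p.2 x i * φ x} := by
    ext p; simp only [mem_iInter]; rfl
  rw [this]
  refine isClosed_iInter fun φ => isClosed_iInter fun hφ => isClosed_iInter fun i => ?_
  obtain ⟨a, w, h⟩ := isWeakGradient_iff hφ i
  simp only [h]
  exact isClosed_eq (by fun_prop) continuous_const

lemma zero_mem_testPairs (D : Domain d) : (0 : L2 D × L2Vec D) ∈ testPairs D := by
  refine ⟨0, ⟨contDiff_const, HasCompactSupport.zero, by simp [tsupport]⟩, ?_, ?_⟩
  · exact Lp.coeFn_zero _ _ _
  · refine (Lp.coeFn_zero _ _ _).trans (ae_of_all _ fun x => ?_)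
    simp [gradient]

lemma add_mem_testPairs {D : Domain d} {p q : L2 D × L2Vec D}
    (hp : p ∈ testPairs D) (hq : q ∈ testPairs D) : p + q ∈ testPairs D := by
  obtain ⟨φ, h, h1, h2⟩ := hp
  obtain ⟨ψ, k, k1, k2⟩ := hq
  refine ⟨φ + ψ, ⟨h.1.add k.1, h.2.1.add k.2.1,
    (tsupport_add φ ψ).trans (union_subset h.2.2 k.2.2)⟩, ?_, ?_⟩
  · exact (Lp.coeFn_add _ _).trans (h1.add k1)
  · refine (Lp.coeFn_add _ _).trans ((h2.add k2).trans (ae_of_all _ fun x => ?_))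
    simp only [gradient]
    rw [fderiv_add (h.1.differentiable (by simp) x) (k.1.differentiable (by simp) x), map_add]
    rfl

lemma smul_mem_testPairs {D : Domain d} (c : ℝ) {p : L2 D × L2Vec D}
    (hp : p ∈ testPairs D) : c • p ∈ testPairs D := by
  obtain ⟨φ, h, h1, h2⟩ := hp
  refine ⟨c • φ, ⟨h.1.const_smul c, h.2.1.smul_left (f := fun _ => c),
    (tsupport_smul_subset_right (fun _ => c) φ).trans h.2.2⟩, ?_, ?_⟩
  · exact (Lp.coeFn_smul _ _).trans (h1.const_smul c)
  · refine (Lp.coeFn_smul _ _).trans ((h2.const_smul c).trans (ae_of_all _ fun x => ?_))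
    simp only [gradient]
    rw [fderiv_const_smul (h.1.differentiable (by simp) x), map_smulₛₗ]
    rfl

/-- The pairs `(φ, ∇φ)` with `φ ∈ C_c^∞(D)`, as a linear subspace. -/
def testSubmodule (D : Domain d) : Submodule ℝ (L2 D × L2Vec D) where
  carrier := testPairs D
  zero_mem' := zero_mem_testPairs D
  add_mem' := add_mem_testPairs
  smul_mem' := fun c _ hp => smul_mem_testPairs c hp

/-- `H¹₀(D)`: the closure of `C_c^∞(D)` in `H¹(D)`, as a subspace of the space of
pairs `(u, ∇u)`. -/
def H10Submodule (D : Domain d) : Submodule ℝ (L2 D × L2Vec D) :=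
  H1 D ⊓ (testSubmodule D).topologicalClosure

lemma isClosed_H10Submodule (D : Domain d) :
    IsClosed (H10Submodule D : Set (L2 D × L2Vec D)) :=
  (isClosed_H1 D).inter isClosed_closure

/-- Integration by parts for a test function against a smooth function. -/
lemma integral_by_parts {D : Domain d} {f φ : EuclideanSpace ℝ (Fin d) → ℝ}
    (hf : ContDiff ℝ (⊤ : ℕ∞) f) (hφ : IsTestFunction D φ) (i : Fin d) :
    ∫ x, f x * partialDeriv i φ x = - ∫ x, partialDeriv i f x * φ x := by
  have hc := hφ.2.1
  refine integral_mul_fderiv_eq_neg_fderiv_mul_of_integrable ?_ ?_ ?_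
    (fun x _ => hf.differentiable (by simp) x) (fun x _ => hφ.1.differentiable (by simp) x)
  · exact Continuous.integrable_of_hasCompactSupport
      (((hf.continuous_fderiv (by simp)).clm_apply continuous_const).mul hφ.1.continuous)
      hc.mul_left
  · exact Continuous.integrable_of_hasCompactSupport
      (hf.continuous.mul (hφ.continuous_partialDeriv i))
      (hφ.hasCompactSupport_partialDeriv i).mul_left
  · exact Continuous.integrable_of_hasCompactSupport
      (hf.continuous.mul hφ.1.continuous) hc.mul_left

lemma setIntegral_eq_integral_of_test {D : Domain d} {φ ψ : EuclideanSpace ℝ (Fin d) → ℝ}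
    (hφ : IsTestFunction D φ) (h : ∀ x, x ∉ tsupport φ → ψ x = 0) :
    ∫ x in D.carrier, ψ x = ∫ x, ψ x :=
  setIntegral_eq_integral_of_forall_compl_eq_zero fun x hx => h x fun h' => hx (hφ.2.2 h')

lemma partialDeriv_eq_zero {i : Fin d} {φ : EuclideanSpace ℝ (Fin d) → ℝ}
    {x : EuclideanSpace ℝ (Fin d)} (hx : x ∉ tsupport φ) : partialDeriv i φ x = 0 := by
  have : fderiv ℝ φ x = 0 := by
    by_contra h
    exact hx (support_fderiv_subset ℝ h)
  simp [partialDeriv, this]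

lemma gradient_apply_eq {φ : EuclideanSpace ℝ (Fin d) → ℝ} (x : EuclideanSpace ℝ (Fin d))
    (i : Fin d) : gradient φ x i = partialDeriv i φ x := by
  have h : inner ℝ (gradient φ x) (EuclideanSpace.single i (1 : ℝ)) = partialDeriv i φ x := by
    rw [gradient, InnerProductSpace.toDual_symm_apply]; rfl
  rw [← h, EuclideanSpace.inner_single_right]; simp

/-- Test functions belong to `H¹(D)`, with their classical gradient. -/
lemma testPairs_subset_H1 (D : Domain d) : testPairs D ⊆ (H1 D : Set (L2 D × L2Vec D)) := by
  rintro p ⟨f, hf, h1, h2⟩ φ hφ i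
  have e1 : ∫ x in D.carrier, p.1 x * partialDeriv i φ x = ∫ x, f x * partialDeriv i φ x := by
    rw [← setIntegral_eq_integral_of_test hφ fun x hx => by rw [partialDeriv_eq_zero hx, mul_zero]]
    refine integral_congr_ae ?_
    filter_upwards [h1] with x hx
    rw [hx]
  have e2 : ∫ x in D.carrier, p.2 x i * φ x = ∫ x, partialDeriv i f x * φ x := by
    rw [← setIntegral_eq_integral_of_test hφ fun x hx => by
      rw [image_eq_zero_of_notMem_tsupport hx, mul_zero]]
    refine integral_congr_ae ?_
    filter_upwards [h2] with x hx
    rw [hx, gradient_apply_eq]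
  rw [e1, e2]
  exact integral_by_parts hf.1 hφ i

/-- Poincaré inequality. -/
lemma poincare [NeZero d] (D : Domain d) :
    ∃ C : ℝ, 0 ≤ C ∧ ∀ p ∈ H10Submodule D, ‖p.1‖ ≤ C * ‖p.2‖ := by
  obtain ⟨R, hR0, hR⟩ : ∃ R : ℝ, 0 ≤ R ∧ ∀ x ∈ D.carrier, ‖x‖ ≤ R := by
    obtain ⟨R, hR⟩ := D.isBounded.exists_norm_le
    obtain ⟨y, hy⟩ := D.nonempty
    exact ⟨R, (norm_nonneg y).trans (hR y hy), hR⟩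
  refine ⟨2 * R, by positivity, ?_⟩
  have key : ∀ p ∈ testPairs D, ‖p.1‖ ≤ 2 * R * ‖p.2‖ := by
    rintro p ⟨φ, hφ, h1, h2⟩
    let i : Fin d := 0
    have hsq : IsTestFunction D (fun x => φ x * φ x) :=
      ⟨hφ.1.mul hφ.1, hφ.2.1.mul_left, (tsupport_mul_subset_left).trans hφ.2.2⟩
    have hX : ContDiff ℝ (⊤ : ℕ∞) (fun x : EuclideanSpace ℝ (Fin d) => x i) :=
      (EuclideanSpace.proj i : EuclideanSpace ℝ (Fin d) →L[ℝ] ℝ).contDiff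
    have hXd : ∀ x, partialDeriv i (fun x : EuclideanSpace ℝ (Fin d) => x i) x = 1 := by
      intro x
      have : fderiv ℝ (fun x : EuclideanSpace ℝ (Fin d) => x i) x =
        (EuclideanSpace.proj i : EuclideanSpace ℝ (Fin d) →L[ℝ] ℝ) :=
        (EuclideanSpace.proj i : EuclideanSpace ℝ (Fin d) →L[ℝ] ℝ).fderiv
      simp [partialDeriv, this]
    have hsqd : ∀ x, partialDeriv i (fun x => φ x * φ x) x = 2 * φ x * partialDeriv i φ x := by
      intro x
      have hd := hφ.1.differentiable (by simp) x
      simp only [partialDeriv]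
      rw [fderiv_fun_mul hd hd]
      simp; ring
    have hibp := integral_by_parts hX hsq i
    simp only [hXd, hsqd, one_mul] at hibp
    have hn1 : ‖p.1‖ ^ 2 = ∫ x in D.carrier, φ x * φ x := by
      rw [← real_inner_self_eq_norm_sq, L2.inner_def]
      refine integral_congr_ae ?_
      filter_upwards [h1] with x hx
      rw [hx]; simp [sq]
    rw [← setIntegral_eq_integral_of_test hφ (ψ := fun x => φ x * φ x)
        (fun x hx => by simp [image_eq_zero_of_notMem_tsupport hx]),
      ← setIntegral_eq_integral_of_test hφ (ψ := fun x => x i * (2 * φ x * partialDeriv i φ x))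
        (fun x hx => by simp [image_eq_zero_of_notMem_tsupport hx]), ← neg_eq_iff_eq_neg] at hibp
    have habs : MemLp (fun x => |φ x|) 2 D.vol := hφ.memLp.abs
    have hgrad : MemLp (fun x => ‖p.2 x‖) 2 D.vol := (Lp.memLp p.2).norm
    have hnA : ‖habs.toLp _‖ = ‖p.1‖ := by
      rw [Lp.norm_toLp, Lp.norm_def]
      congr 1
      refine eLpNorm_congr_norm_ae ?_
      filter_upwards [h1] with x hx
      rw [hx]; simp
    have hnG : ‖hgrad.toLp _‖ = ‖p.2‖ := by
      rw [Lp.norm_toLp, Lp.norm_def, eLpNorm_norm]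
    have hCS : ∫ x in D.carrier, |φ x| * ‖p.2 x‖ ≤ ‖p.1‖ * ‖p.2‖ := by
      rw [← hnA, ← hnG]
      refine le_trans (le_of_eq ?_) (real_inner_le_norm _ _)
      rw [L2.inner_def]
      refine integral_congr_ae ?_
      filter_upwards [habs.coeFn_toLp, hgrad.coeFn_toLp] with x hx hx'
      rw [hx, hx']; simp [mul_comm]
    have hint : Integrable (fun x => |φ x| * ‖p.2 x‖) D.vol := habs.integrable_mul hgrad
    have hle : ‖p.1‖ ^ 2 ≤ 2 * R * ∫ x in D.carrier, |φ x| * ‖p.2 x‖ := by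
      rw [hn1, ← hibp, ← integral_neg, ← integral_const_mul]
      refine integral_mono_ae ?_ (hint.const_mul _) ?_
      · refine (Continuous.integrable_of_hasCompactSupport ?_ ?_).neg.integrableOn
        · exact hX.continuous.mul ((continuous_const.mul hφ.1.continuous).mul
            (hφ.continuous_partialDeriv i))
        · exact ((hφ.hasCompactSupport_partialDeriv i).mul_left).mul_left
      · filter_upwards [h2, ae_restrict_mem D.isOpen.measurableSet] with x hx hxD
        have b1 : |x i| ≤ R := (by simpa using PiLp.norm_apply_le x i : |x i| ≤ ‖x‖).trans (hR x hxD)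
        have b2 : |partialDeriv i φ x| ≤ ‖p.2 x‖ := by
          rw [hx, ← gradient_apply_eq]
          simpa using PiLp.norm_apply_le (gradient φ x) i
        calc -(x i * (2 * φ x * partialDeriv i φ x))
            ≤ |x i * (2 * φ x * partialDeriv i φ x)| := neg_le_abs _
          _ = |x i| * (2 * (|φ x| * |partialDeriv i φ x|)) := by
              simp only [abs_mul, abs_two, mul_assoc]
          _ ≤ R * (2 * (|φ x| * ‖p.2 x‖)) := by gcongr
          _ = 2 * R * (|φ x| * ‖p.2 x‖) := by ring
    have hfin : ‖p.1‖ ^ 2 ≤ 2 * R * (‖p.1‖ * ‖p.2‖) :=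
      hle.trans (mul_le_mul_of_nonneg_left hCS (by positivity))
    rcases (norm_nonneg p.1).eq_or_lt with h0 | h0
    · rw [← h0]; positivity
    · have : ‖p.1‖ * ‖p.1‖ ≤ ‖p.1‖ * (2 * R * ‖p.2‖) := by nlinarith
      exact le_of_mul_le_mul_left this h0
  intro p hp
  exact closure_minimal (t := {p : L2 D × L2Vec D | ‖p.1‖ ≤ 2 * R * ‖p.2‖}) key
    (isClosed_le (by fun_prop) (by fun_prop)) hp.2

/-- The space `Y = H¹₀(D)`, which will be normed by `‖y‖_Y = ‖∇y‖_{L²(D)}`. -/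
def H10 (D : Domain d) : Type := H10Submodule D

namespace H10

instance (D : Domain d) : AddCommGroup (H10 D) := inferInstanceAs (AddCommGroup (H10Submodule D))

instance (D : Domain d) : Module ℝ (H10 D) := inferInstanceAs (Module ℝ (H10Submodule D))

variable {D : Domain d}

/-- The underlying `L²` function. -/
def val : H10 D →ₗ[ℝ] L2 D := (LinearMap.fst ℝ _ _).comp (H10Submodule D).subtype

/-- The gradient. -/
def grad : H10 D →ₗ[ℝ] L2Vec D := (LinearMap.snd ℝ _ _).comp (H10Submodule D).subtype

variable [NeZero d]

lemma eq_zero_of_grad (u : H10 D) (h : grad u = 0) : u = 0 := by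
  obtain ⟨C, -, hC⟩ := poincare D
  have h1 := hC u.1 u.2
  have h2 : u.1.2 = 0 := h
  rw [h2, norm_zero, mul_zero] at h1
  exact Subtype.ext (Prod.ext (norm_le_zero_iff.1 h1) h2)

/-- The scalar product `(u, v)_Y = ∫_D ∇u · ∇v`. -/
@[reducible]
def core (D : Domain d) : InnerProductSpace.Core ℝ (H10 D) where
  inner u v := inner ℝ (grad u) (grad v)
  conj_inner_symm u v := by simp [real_inner_comm]
  re_inner_nonneg u := real_inner_self_nonneg (F := L2Vec D)
  add_left u v w := by simp [inner_add_left]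
  smul_left u v r := by simp [inner_smul_left]
  definite u h := eq_zero_of_grad u (inner_self_eq_zero.1 h)

instance : NormedAddCommGroup (H10 D) := (core D).toNormedAddCommGroup

instance : InnerProductSpace ℝ (H10 D) := InnerProductSpace.ofCore (core D).toCore

lemma inner_eq (u v : H10 D) : inner ℝ u v = inner ℝ (grad u) (grad v) := rfl

lemma norm_eq (u : H10 D) : ‖u‖ = ‖grad u‖ := by
  rw [norm_eq_sqrt_real_inner, norm_eq_sqrt_real_inner, inner_eq]

lemma norm_val_le (D : Domain d) : ∃ C : ℝ, 0 ≤ C ∧ ∀ u : H10 D, ‖val u‖ ≤ C * ‖u‖ := by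
  obtain ⟨C, h0, hC⟩ := poincare D
  exact ⟨C, h0, fun u => by rw [norm_eq]; exact hC u.1 u.2⟩

instance : CompleteSpace (H10 D) := by
  obtain ⟨C, h0, hC⟩ := norm_val_le D
  let T : H10 D →L[ℝ] L2 D × L2Vec D :=
    LinearMap.mkContinuous (H10Submodule D).subtype (max C 1) fun u => by
      refine (Prod.norm_def _).trans_le (max_le ?_ ?_)
      · exact (hC u).trans (by gcongr; exact le_max_left _ _)
      · exact (norm_eq u).ge.trans (le_mul_of_one_le_left (norm_nonneg _) (le_max_right _ _))
  have hT : AntilipschitzWith 1 T := by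
    refine AddMonoidHomClass.antilipschitz_of_bound T fun u => ?_
    rw [NNReal.coe_one, one_mul, norm_eq]
    exact norm_snd_le (T u)
  have hr : range T = H10Submodule D := Subtype.range_val
  have hcl : IsClosed (range T) := hr ▸ isClosed_H10Submodule D
  have hu := hT.isUniformInducing T.uniformContinuous
  exact (completeSpace_iff_isComplete_range hu).2 hcl.isComplete

end H10
/-- Extension by zero to `ℝ^d` of a function on the closure of `D`. -/
def extendZero {D : Domain d} (K : C(closure D.carrier, ℝ)) : EuclideanSpace ℝ (Fin d) → ℝ :=
  Function.extend Subtype.val K 0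

instance (D : Domain d) : CompactSpace (closure D.carrier) :=
  isCompact_iff_compactSpace.1 D.isBounded.isCompact_closure

instance (D : Domain d) : Nonempty (closure D.carrier) := D.nonempty.closure.to_subtype

lemma extendZero_apply {D : Domain d} (K : C(closure D.carrier, ℝ))
    {x : EuclideanSpace ℝ (Fin d)} (hx : x ∈ D.carrier) :
    extendZero K x = K ⟨x, subset_closure hx⟩ :=
  Subtype.val_injective.extend_apply K 0 ⟨x, subset_closure hx⟩

lemma measurable_extendZero {D : Domain d} (K : C(closure D.carrier, ℝ)) :
    Measurable (extendZero K) :=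
  (MeasurableEmbedding.subtype_coe isClosed_closure.measurableSet).measurable_extend
    K.continuous.measurable measurable_const

/-- The bilinear form `(u, v) ↦ ∫_D K ∇u · ∇v` on `Y` for a coefficient `K ∈ C⁰(closure D)`. -/
def form {D : Domain d} (K : C(closure D.carrier, ℝ)) (u v : H10 D) : ℝ :=
  ∫ x in D.carrier, extendZero K x * inner ℝ (H10.grad u x) (H10.grad v x)

section Form

variable {D : Domain d}

lemma integrable_form (K : C(closure D.carrier, ℝ)) (u v : H10 D) :
    Integrable (fun x => extendZero K x * inner ℝ (H10.grad u x) (H10.grad v x)) D.vol := by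
  refine (L2.integrable_inner (𝕜 := ℝ) (H10.grad u) (H10.grad v)).bdd_mul (c := ‖K‖)
    (measurable_extendZero K).aestronglyMeasurable ?_
  filter_upwards [ae_restrict_mem D.isOpen.measurableSet] with x hx
  rw [extendZero_apply K hx]
  exact K.norm_coe_le_norm _

lemma form_comm (K : C(closure D.carrier, ℝ)) (u v : H10 D) : form K u v = form K v u := by
  simp only [form, real_inner_comm]

lemma form_add_left (K : C(closure D.carrier, ℝ)) (u v w : H10 D) :
    form K (u + v) w = form K u w + form K v w := by
  rw [form, form, form, ← integral_add (integrable_form K u w) (integrable_form K v w)]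
  refine integral_congr_ae ?_
  filter_upwards [Lp.coeFn_add (H10.grad u) (H10.grad v)] with x hx
  rw [map_add, hx, Pi.add_apply, inner_add_left, mul_add]

lemma form_smul_left (K : C(closure D.carrier, ℝ)) (c : ℝ) (u w : H10 D) :
    form K (c • u) w = c * form K u w := by
  rw [form, form, ← integral_const_mul]
  refine integral_congr_ae ?_
  filter_upwards [Lp.coeFn_smul c (H10.grad u)] with x hx
  rw [map_smul, hx, Pi.smul_apply, real_inner_smul_left]
  ring

lemma form_add_right (K : C(closure D.carrier, ℝ)) (u v w : H10 D) :
    form K w (u + v) = form K w u + form K w v := by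
  rw [form_comm, form_add_left, form_comm K u, form_comm K v]

lemma form_smul_right (K : C(closure D.carrier, ℝ)) (c : ℝ) (u w : H10 D) :
    form K w (c • u) = c * form K w u := by
  rw [form_comm, form_smul_left, form_comm]

lemma form_add_field (K L : C(closure D.carrier, ℝ)) (u v : H10 D) :
    form (K + L) u v = form K u v + form L u v := by
  rw [form, form, form, ← integral_add (integrable_form K u v) (integrable_form L u v)]
  refine integral_congr_ae ?_
  filter_upwards [ae_restrict_mem D.isOpen.measurableSet] with x hx
  rw [extendZero_apply _ hx, extendZero_apply _ hx, extendZero_apply _ hx, ContinuousMap.add_apply,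
    add_mul]

lemma form_mono {K : C(closure D.carrier, ℝ)} {c : ℝ} (hK : ∀ x, c ≤ K x)
    [NeZero d] (u : H10 D) : c * ‖u‖ ^ 2 ≤ form K u u := by
  rw [← real_inner_self_eq_norm_sq, H10.inner_eq, L2.inner_def, ← integral_const_mul, form]
  refine integral_mono_ae ((L2.integrable_inner (𝕜 := ℝ) _ _).const_mul _)
    (integrable_form K u u) ?_
  filter_upwards [ae_restrict_mem D.isOpen.measurableSet] with x hx
  rw [extendZero_apply _ hx]
  exact mul_le_mul_of_nonneg_right (hK _) real_inner_self_nonneg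

lemma form_self_nonneg {K : C(closure D.carrier, ℝ)} (hK : ∀ x, 0 ≤ K x) [NeZero d]
    (u : H10 D) : 0 ≤ form K u u := by
  simpa using form_mono hK u

lemma abs_form_le_add {K : C(closure D.carrier, ℝ)} (hK : ∀ x, 0 ≤ K x) [NeZero d]
    (u v : H10 D) : |form K u v| ≤ form K u u + form K v v := by
  have h1 := form_self_nonneg hK (u + v)
  have h2 := form_self_nonneg hK (u + (-1 : ℝ) • v)
  have h3 := form_self_nonneg hK u
  have h4 := form_self_nonneg hK v
  simp only [form_add_left, form_add_right, form_smul_left, form_smul_right,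
    form_comm K v u] at h1 h2
  rw [abs_le]
  constructor <;> linarith

lemma abs_form_le (K : C(closure D.carrier, ℝ)) [NeZero d] (u v : H10 D) :
    |form K u v| ≤ ‖K‖ * ‖u‖ * ‖v‖ := by
  have hu : ‖(Lp.memLp (H10.grad u)).norm.toLp _‖ = ‖u‖ := by
    rw [Lp.norm_toLp, H10.norm_eq, Lp.norm_def, eLpNorm_norm]
  have hv : ‖(Lp.memLp (H10.grad v)).norm.toLp _‖ = ‖v‖ := by
    rw [Lp.norm_toLp, H10.norm_eq, Lp.norm_def, eLpNorm_norm]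
  have hCS : ∫ x in D.carrier, ‖H10.grad u x‖ * ‖H10.grad v x‖ ≤ ‖u‖ * ‖v‖ := by
    rw [← hu, ← hv]
    refine le_trans (le_of_eq ?_) (real_inner_le_norm _ _)
    rw [L2.inner_def]
    refine integral_congr_ae ?_
    filter_upwards [(Lp.memLp (H10.grad u)).norm.coeFn_toLp,
      (Lp.memLp (H10.grad v)).norm.coeFn_toLp] with x hx hx'
    rw [hx, hx', real_inner_comm]; rfl
  have hint : Integrable (fun x => ‖H10.grad u x‖ * ‖H10.grad v x‖) D.vol :=
    (Lp.memLp (H10.grad u)).norm.integrable_mul (Lp.memLp (H10.grad v)).norm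
  rw [mul_assoc]
  refine le_trans ?_ (mul_le_mul_of_nonneg_left hCS (norm_nonneg K))
  rw [← integral_const_mul, form, ← Real.norm_eq_abs]
  refine norm_integral_le_of_norm_le (hint.const_mul _) ?_
  filter_upwards [ae_restrict_mem D.isOpen.measurableSet] with x hx
  rw [extendZero_apply _ hx, norm_mul]
  exact mul_le_mul (K.norm_coe_le_norm _) (norm_inner_le_norm _ _) (norm_nonneg _) (norm_nonneg _)

lemma continuous_form [NeZero d] :
    Continuous fun p : C(closure D.carrier, ℝ) × H10 D × H10 D => form p.1 p.2.1 p.2.2 := by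
  rw [continuous_iff_continuousAt]
  rintro ⟨K, u, v⟩
  rw [ContinuousAt, tendsto_iff_norm_sub_tendsto_zero]
  have hid : ∀ p : C(closure D.carrier, ℝ) × H10 D × H10 D,
      form p.1 p.2.1 p.2.2 - form K u v =
        form (p.1 - K) p.2.1 p.2.2 + form K (p.2.1 - u) p.2.2 + form K u (p.2.2 - v) := by
    intro p
    have e1 := form_add_field (p.1 - K) K p.2.1 p.2.2
    have e2 := form_add_left K (p.2.1 - u) u p.2.2
    have e3 := form_add_right K (p.2.2 - v) v u
    rw [sub_add_cancel] at e1 e2 e3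
    linarith
  refine squeeze_zero (g := fun p : C(closure D.carrier, ℝ) × H10 D × H10 D =>
    ‖p.1 - K‖ * ‖p.2.1‖ * ‖p.2.2‖ + ‖K‖ * ‖p.2.1 - u‖ * ‖p.2.2‖ + ‖K‖ * ‖u‖ * ‖p.2.2 - v‖)
    (fun _ => norm_nonneg _) (fun p => ?_) ?_
  · rw [hid]
    refine (norm_add₃_le).trans ?_
    exact add_le_add (add_le_add (abs_form_le _ _ _) (abs_form_le _ _ _)) (abs_form_le _ _ _)
  · refine Continuous.tendsto' (by fun_prop) _ _ ?_
    simp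

end Form

/-- A random diffusion field on `D` over the probability space `(Ω, P)`: a random variable with
values in `C⁰(closure D)` (with its Borel `σ`-algebra), almost surely positive, such that
`κ_max = max κ` and `1 / κ_min = 1 / min κ` (extrema over the closure of `D`) belong to `L^p(Ω)`
for some `p ∈ [1, ∞]`. -/
structure DiffusionField (D : Domain d) {Ω : Type*} [MeasurableSpace Ω] (P : Measure Ω) where
  toFun : Ω → C(closure D.carrier, ℝ)
  measurable_toFun : @Measurable Ω C(closure D.carrier, ℝ) _ (borel _) toFun
  pos : ∀ᵐ ω ∂P, ∀ x, 0 < toFun ω x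
  exists_memLp : ∃ p : ℝ≥0∞, 1 ≤ p ∧ MemLp (fun ω => ⨆ x, toFun ω x) p P ∧
    MemLp (fun ω => 1 / ⨅ x, toFun ω x) p P

namespace DiffusionField

variable {D : Domain d} {Ω : Type*} [MeasurableSpace Ω] {P : Measure Ω}

/-- `κ_min(ω) = min κ(·, ω)`. -/
def min (κ : DiffusionField D P) (ω : Ω) : ℝ := ⨅ x, κ.toFun ω x

/-- `κ_max(ω) = max κ(·, ω)`. -/
def max (κ : DiffusionField D P) (ω : Ω) : ℝ := ⨆ x, κ.toFun ω x

lemma min_le (κ : DiffusionField D P) (ω : Ω) (x : closure D.carrier) :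
    κ.min ω ≤ κ.toFun ω x :=
  ciInf_le (isCompact_range (κ.toFun ω).continuous).bddBelow x

lemma min_pos (κ : DiffusionField D P) : ∀ᵐ ω ∂P, 0 < κ.min ω := by
  filter_upwards [κ.pos] with ω h
  obtain ⟨x, -, hx⟩ := isCompact_univ.exists_isMinOn univ_nonempty
    (κ.toFun ω).continuous.continuousOn
  exact (h x).trans_le (le_ciInf fun y => hx (mem_univ y))

lemma integrable_inv_min [IsProbabilityMeasure P] (κ : DiffusionField D P) :
    Integrable (fun ω => 1 / κ.min ω) P := by
  obtain ⟨p, hp, -, h⟩ := κ.exists_memLp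
  exact h.integrable hp

lemma stronglyMeasurable (κ : DiffusionField D P) : StronglyMeasurable κ.toFun := by
  let _ : MeasurableSpace C(closure D.carrier, ℝ) := borel _
  have : BorelSpace C(closure D.carrier, ℝ) := ⟨rfl⟩
  exact Measurable.stronglyMeasurable κ.measurable_toFun

variable [NeZero d]

lemma aestronglyMeasurable_form (κ : DiffusionField D P) (u v : Ω →ₘ[P] H10 D) :
    AEStronglyMeasurable (fun ω => form (κ.toFun ω) (u ω) (v ω)) P :=
  continuous_form.comp_aestronglyMeasurable (κ.stronglyMeasurable.aestronglyMeasurable.prodMk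
    (u.aestronglyMeasurable.prodMk v.aestronglyMeasurable))

lemma integrable_form_of_self (κ : DiffusionField D P) {u v : Ω →ₘ[P] H10 D}
    (hu : Integrable (fun ω => form (κ.toFun ω) (u ω) (u ω)) P)
    (hv : Integrable (fun ω => form (κ.toFun ω) (v ω) (v ω)) P) :
    Integrable (fun ω => form (κ.toFun ω) (u ω) (v ω)) P := by
  refine (hu.add hv).mono' (κ.aestronglyMeasurable_form u v) ?_
  filter_upwards [κ.pos] with ω h
  exact abs_form_le_add (fun x => (h x).le) _ _

/-- The energy space, as a subspace of the space of `P`-a.s. equivalence classes of (strongly)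
measurable functions `v : Ω → Y`: those `v` with `∫_Ω a_ω(v_ω, v_ω) dP < ∞`, where
`a_ω(u, v) = ∫_D κ(·, ω) ∇u · ∇v`. -/
def energySubmodule (κ : DiffusionField D P) : Submodule ℝ (Ω →ₘ[P] H10 D) where
  carrier := {v | Integrable (fun ω => form (κ.toFun ω) (v ω) (v ω)) P}
  zero_mem' := by
    refine (integrable_zero Ω ℝ P).congr ?_
    filter_upwards [AEEqFun.coeFn_zero (β := H10 D) (μ := P)] with ω h
    rw [h]
    have := form_smul_left (κ.toFun ω) 0 0 0
    simpa using this.symm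
  add_mem' := fun {u v} hu hv => by
    have huv := κ.integrable_form_of_self hu hv
    refine ((hu.add hv).add (huv.add huv)).congr ?_
    filter_upwards [AEEqFun.coeFn_add u v] with ω h
    rw [h]
    simp only [Pi.add_apply, form_add_left, form_add_right, form_comm _ (v ω) (u ω)]
    ring
  smul_mem' := fun c u hu => by
    refine (Integrable.const_mul hu (c * c)).congr ?_
    filter_upwards [AEEqFun.coeFn_smul c u] with ω h
    rw [h]
    simp only [Pi.smul_apply, form_smul_left, form_smul_right]
    ring

/-- The energy space, which will be normed by the energy norm. -/
def EnergySpace (κ : DiffusionField D P) : Type _ := κ.energySubmodule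

namespace EnergySpace

variable {κ : DiffusionField D P}

instance : AddCommGroup κ.EnergySpace := inferInstanceAs (AddCommGroup κ.energySubmodule)

instance : Module ℝ κ.EnergySpace := inferInstanceAs (Module ℝ κ.energySubmodule)

/-- The underlying (class of a) function `Ω → Y`. -/
def val : κ.EnergySpace →ₗ[ℝ] (Ω →ₘ[P] H10 D) := κ.energySubmodule.subtype

/-- The bilinear form `a(u, v) = ∫_Ω a_ω(u_ω, v_ω) dP(ω)`. -/
def a (u v : κ.EnergySpace) : ℝ := ∫ ω, form (κ.toFun ω) (val u ω) (val v ω) ∂P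

lemma integrable_form (u v : κ.EnergySpace) :
    Integrable (fun ω => form (κ.toFun ω) (val u ω) (val v ω)) P :=
  κ.integrable_form_of_self u.2 v.2

/-- The scalar product of the energy space is `a`. -/
@[reducible]
def core (κ : DiffusionField D P) : InnerProductSpace.Core ℝ κ.EnergySpace where
  inner u v := a u v
  conj_inner_symm u v := by simp [a, form_comm]
  re_inner_nonneg u := by
    refine integral_nonneg_of_ae ?_
    filter_upwards [κ.pos] with ω h
    exact form_self_nonneg (fun x => (h x).le) _
  add_left u v w := by
    rw [a, a, a, ← integral_add (integrable_form u w) (integrable_form v w)]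
    refine integral_congr_ae ?_
    filter_upwards [AEEqFun.coeFn_add (val u) (val v)] with ω h
    rw [map_add, h, Pi.add_apply, form_add_left]
  smul_left u v r := by
    rw [a, a, ← integral_const_mul]
    refine integral_congr_ae ?_
    filter_upwards [AEEqFun.coeFn_smul r (val u)] with ω h
    rw [map_smul, h, Pi.smul_apply, form_smul_left]
    simp
  definite u h := by
    have h0 : 0 ≤ᵐ[P] fun ω => form (κ.toFun ω) (val u ω) (val u ω) := by
      filter_upwards [κ.pos] with ω h
      exact form_self_nonneg (fun x => (h x).le) _
    have h1 := (integral_eq_zero_iff_of_nonneg_ae h0 (integrable_form u u)).1 h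
    refine Subtype.ext (AEEqFun.ext ?_)
    filter_upwards [h1, κ.min_pos, AEEqFun.coeFn_zero (β := H10 D) (μ := P)] with ω h2 h3 h4
    have h5 := form_mono (κ.min_le ω) (val u ω)
    rw [h2, Pi.zero_apply] at h5
    have h6 : ‖val u ω‖ ^ 2 ≤ 0 := by
      by_contra hc
      exact absurd h5 (not_le.2 (mul_pos h3 (not_le.1 hc)))
    have h7 : val u ω = 0 := by
      rw [← norm_eq_zero]
      exact pow_eq_zero_iff (two_ne_zero) |>.1 (le_antisymm h6 (sq_nonneg _))
    exact h7.trans h4.symm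

instance : NormedAddCommGroup κ.EnergySpace := (core κ).toNormedAddCommGroup

instance : InnerProductSpace ℝ κ.EnergySpace := InnerProductSpace.ofCore (core κ).toCore

lemma inner_eq (u v : κ.EnergySpace) : inner ℝ u v = a u v := rfl

lemma norm_sq_eq (u : κ.EnergySpace) : ‖u‖ ^ 2 = a u u := by
  rw [← real_inner_self_eq_norm_sq, inner_eq]

lemma ae_norm_le (u : κ.EnergySpace) : ∀ᵐ ω ∂P,
    ‖val u ω‖ ≤ 1 / κ.min ω + form (κ.toFun ω) (val u ω) (val u ω) := by
  filter_upwards [κ.min_pos] with ω h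
  have h1 := form_mono (κ.min_le ω) (val u ω)
  refine le_trans ?_ (add_le_add_right h1 _)
  have h2 : κ.min ω * (1 / κ.min ω) = 1 := mul_one_div_cancel h.ne'
  have h3 : 0 < 1 / κ.min ω := by positivity
  nlinarith [mul_nonneg h3.le (sq_nonneg (κ.min ω * ‖val u ω‖ - 1 / 2)), norm_nonneg (val u ω),
    mul_nonneg h3.le (sq_nonneg (κ.min ω * ‖val u ω‖)),
    congrArg (· * ‖val u ω‖) h2, congrArg (· * (κ.min ω * ‖val u ω‖ ^ 2)) h2]

lemma integral_val_smul (c : ℝ) (u : κ.EnergySpace) :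
    ∫ ω, val (c • u) ω ∂P = c • ∫ ω, val u ω ∂P := by
  rw [← integral_smul]
  refine integral_congr_ae ?_
  filter_upwards [AEEqFun.coeFn_smul c (val u)] with ω h
  rw [map_smul, h, Pi.smul_apply]

variable [IsProbabilityMeasure P]

lemma integrable (u : κ.EnergySpace) : Integrable (val u) P :=
  (κ.integrable_inv_min.add (integrable_form u u)).mono' (val u).aestronglyMeasurable
    (ae_norm_le u)

lemma integral_norm_le (u : κ.EnergySpace) (hu : ‖u‖ ≤ 1) :
    ∫ ω, ‖val u ω‖ ∂P ≤ (∫ ω, 1 / κ.min ω ∂P) + 1 := by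
  have h : a u u ≤ 1 := by
    rw [← norm_sq_eq]; exact pow_le_one₀ (norm_nonneg _) hu
  refine le_trans ?_ (add_le_add_right h _)
  rw [a, ← integral_add κ.integrable_inv_min (integrable_form u u)]
  exact integral_mono_ae (integrable u).norm (κ.integrable_inv_min.add (integrable_form u u))
    (ae_norm_le u)

lemma integral_val_add (u v : κ.EnergySpace) :
    ∫ ω, val (u + v) ω ∂P = (∫ ω, val u ω ∂P) + ∫ ω, val v ω ∂P := by
  rw [← integral_add (integrable u) (integrable v)]
  refine integral_congr_ae ?_
  filter_upwards [AEEqFun.coeFn_add (val u) (val v)] with ω h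
  rw [map_add, h, Pi.add_apply]

lemma norm_integral_le (u : κ.EnergySpace) :
    ‖∫ ω, val u ω ∂P‖ ≤ ((∫ ω, 1 / κ.min ω ∂P) + 1) * ‖u‖ := by
  rcases eq_or_ne u 0 with rfl | h
  · have h0 := integral_val_smul 0 (0 : κ.EnergySpace)
    rw [zero_smul, zero_smul] at h0
    rw [h0]; simp
  · have hu : 0 < ‖u‖ := norm_pos_iff.2 h
    have h1 : ‖‖u‖⁻¹ • u‖ ≤ 1 := by
      rw [norm_smul, norm_inv, norm_norm, inv_mul_cancel₀ hu.ne']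
    have h2 := (norm_integral_le_integral_norm _).trans (integral_norm_le _ h1)
    rw [integral_val_smul, norm_smul, norm_inv, norm_norm, inv_mul_le_iff₀ hu] at h2
    rwa [mul_comm]

end EnergySpace

open EnergySpace

/-- The operator `𝓐` from the energy space to its dual, `⟨𝓐 u, v⟩ = a(u, v)`. -/
def opA (κ : DiffusionField D P) : κ.EnergySpace →L[ℝ] StrongDual ℝ κ.EnergySpace :=
  innerSL ℝ

lemma opA_apply (κ : DiffusionField D P) (u v : κ.EnergySpace) : κ.opA u v = a u v := rfl

variable [IsProbabilityMeasure P]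

/-- The operator `𝓘` from `Y⋆` to the dual of the energy space, `⟨𝓘 f, v⟩ = E[⟨f, v_ω⟩]`. -/
def opI (κ : DiffusionField D P) : StrongDual ℝ (H10 D) →L[ℝ] StrongDual ℝ κ.EnergySpace :=
  LinearMap.mkContinuous₂
    (LinearMap.mk₂ ℝ (fun (f : StrongDual ℝ (H10 D)) (v : κ.EnergySpace) => ∫ ω, f (val v ω) ∂P)
      (fun f g v => integral_add (f.integrable_comp v.integrable) (g.integrable_comp v.integrable))
      (fun c f v => integral_const_mul c _)
      (fun f u v => by
        rw [f.integral_comp_comm (integrable _), f.integral_comp_comm (integrable _),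
          f.integral_comp_comm (integrable _), integral_val_add, map_add])
      (fun c f v => by
        rw [f.integral_comp_comm (integrable _), f.integral_comp_comm (integrable _),
          integral_val_smul, map_smul]))
    ((∫ ω, 1 / κ.min ω ∂P) + 1) (fun f v => by
      rw [LinearMap.mk₂_apply, f.integral_comp_comm (integrable _), mul_comm _ ‖f‖, mul_assoc]
      exact (f.le_opNorm _).trans
        (mul_le_mul_of_nonneg_left (norm_integral_le v) (norm_nonneg f)))

lemma opI_apply (κ : DiffusionField D P) (f : StrongDual ℝ (H10 D)) (v : κ.EnergySpace) :
    κ.opI f v = ∫ ω, f (val v ω) ∂P := rfl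

/-- `G`: the elements of the energy space with zero mean `E[v] = 0` (a Bochner integral in `Y`). -/
def G (κ : DiffusionField D P) : Submodule ℝ κ.EnergySpace where
  carrier := {v | ∫ ω, val v ω ∂P = 0}
  zero_mem' := by
    have h0 := integral_val_smul 0 (0 : κ.EnergySpace)
    rwa [zero_smul, zero_smul] at h0
  add_mem' := fun {u v} hu hv => (integral_val_add u v).trans (by rw [hu, hv, add_zero])
  smul_mem' := fun c u hu => (integral_val_smul c u).trans (by rw [hu, smul_zero])

/-- The polar space `G⁰` of `G` in the dual of the energy space. -/
def G0 (κ : DiffusionField D P) : Set (StrongDual ℝ κ.EnergySpace) :=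
  {F | ∀ v ∈ κ.G, F v = 0}

/-- `G^⊥`: the elements of the energy space that are `a`-orthogonal to `G`; a normed space with
the energy norm. -/
def Gperp (κ : DiffusionField D P) : Submodule ℝ κ.EnergySpace := κ.Gᗮ

lemma mem_Gperp_iff (κ : DiffusionField D P) (y : κ.EnergySpace) :
    y ∈ κ.Gperp ↔ ∀ v ∈ κ.G, a y v = 0 :=
  Submodule.mem_orthogonal' _ _

/-- The Riesz isomorphism `Λ_Y : Y → Y⋆`, `⟨Λ_Y u, v⟩ = (u, v)_Y`. -/
def riesz (D : Domain d) : H10 D ≃ StrongDual ℝ (H10 D) :=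
  (InnerProductSpace.toDual ℝ (H10 D)).toEquiv

/-- The map `𝓔⁻¹ = Λ_Y⁻¹ 𝓘⁻¹ 𝓐 : G^⊥ → Y`. Here `Function.invFun κ.opI` is the inverse of `𝓘` on
its range whenever `𝓘` is injective. -/
def Einv (κ : DiffusionField D P) (y : κ.Gperp) : H10 D :=
  (riesz D).symm (Function.invFun κ.opI (κ.opA y))

end DiffusionField

end RobustOCP
end

/-!
Write `E[v]` for the mean of `v` in the energy space `V`. Two facts about the mean carry everything.

* Constant functions embed `Y` into `V` with `‖const y‖² ≤ E[κ_max] ‖y‖²`, and `E[const y] = y`.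
* By the Cauchy-Schwarz inequality, `‖E[v]‖² ≤ E[1/κ_min] ‖v‖²` (`norm_integral_val_sq_le`).

Since `𝓘 f = f ∘ E`, the first fact makes `𝓘` injective, and a functional `F` that vanishes on
`G = ker E` satisfies `F v = F (const E[v])`, so that `F = 𝓘 f` with `f y = F (const y)`. Hence
`u = 𝓔⁻¹ y` is characterised by `a(y, v) = (u, E[v])_Y` for all `v ∈ V` (`Einv_eq_iff`). Testing with
`v = const u` yields the upper bound for `‖u‖`, and testing with `v = y` yields the lower one.

Surjectivity of `𝓔⁻¹` asks for the Riesz representative in `V` of `v ↦ (u, E[v])_Y`. Instead of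
proving that `V` is complete, the representative is constructed pathwise: `y_ω` is the Lax-Milgram
solution of `∫_D κ(·, ω) ∇y_ω · ∇v = (u, v)_Y`. It depends continuously on the positive coefficient
(`continuousAt_solution`), hence is measurable in `ω`, and it has finite energy because
`κ_min ‖y_ω‖ ≤ ‖u‖`.
-/

noncomputable section

namespace RobustOCP

open MeasureTheory Set Filter Topology

variable {d : ℕ} {D : Domain d}

/-! ### The elliptic problem for a fixed coefficient -/

section Solution

variable [NeZero d]

lemma form_le {K : C(closure D.carrier, ℝ)} {c : ℝ} (hK : ∀ x, K x ≤ c) (u : H10 D) :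
    form K u u ≤ c * ‖u‖ ^ 2 := by
  rw [← real_inner_self_eq_norm_sq, H10.inner_eq, L2.inner_def, ← integral_const_mul, form]
  refine integral_mono_ae (integrable_form K u u)
    ((L2.integrable_inner (𝕜 := ℝ) _ _).const_mul _) ?_
  filter_upwards [ae_restrict_mem D.isOpen.measurableSet] with x hx
  rw [extendZero_apply _ hx]
  exact mul_le_mul_of_nonneg_right (hK _) real_inner_self_nonneg

lemma exists_forall_form_eq_inner {K : C(closure D.carrier, ℝ)} {c : ℝ} (hc : 0 < c)
    (hK : ∀ x, c ≤ K x) (u : H10 D) : ∃ y, ∀ v, form K y v = inner ℝ u v := by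
  let B : H10 D →L[ℝ] H10 D →L[ℝ] ℝ := LinearMap.mkContinuous₂
    (LinearMap.mk₂ ℝ (form K) (form_add_left K) (form_smul_left K)
      (fun w u v => form_add_right K u v w) (fun c w u => form_smul_right K c u w))
    ‖K‖ (fun u v => abs_form_le K u v)
  have hB : IsCoercive B :=
    ⟨c, hc, fun u => by rw [mul_assoc, ← sq]; exact form_mono hK u⟩
  refine ⟨hB.continuousLinearEquivOfBilin.symm u, fun v => ?_⟩
  have := hB.continuousLinearEquivOfBilin_apply (hB.continuousLinearEquivOfBilin.symm u) v
  rw [ContinuousLinearEquiv.apply_symm_apply] at this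
  exact this.symm

open Classical in
/-- The solution `y ∈ Y` of `∫_D K ∇y · ∇v = (u, v)_Y` for all `v ∈ Y`, and `0` if there is none.
For a coefficient `K` bounded below by a positive constant there is exactly one. -/
def solution (u : H10 D) (K : C(closure D.carrier, ℝ)) : H10 D :=
  if h : ∃ y, ∀ v, form K y v = inner ℝ u v then h.choose else 0

lemma form_solution {K : C(closure D.carrier, ℝ)} {c : ℝ} (hc : 0 < c) (hK : ∀ x, c ≤ K x)
    (u v : H10 D) : form K (solution u K) v = inner ℝ u v := by
  have h := exists_forall_form_eq_inner hc hK u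
  rw [solution, dif_pos h]
  exact h.choose_spec v

lemma le_div_of_mul_sq_le {a b c : ℝ} (hc : 0 < c) (ha : 0 ≤ a) (hb : 0 ≤ b)
    (h : c * a ^ 2 ≤ b * a) : a ≤ b / c := by
  rw [le_div_iff₀ hc]
  rcases ha.eq_or_lt with rfl | ha
  · simpa using hb
  · exact le_of_mul_le_mul_right (by nlinarith) ha

lemma norm_solution_le {K : C(closure D.carrier, ℝ)} {c : ℝ} (hc : 0 < c) (hK : ∀ x, c ≤ K x)
    (u : H10 D) : ‖solution u K‖ ≤ ‖u‖ / c := by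
  refine le_div_of_mul_sq_le hc (norm_nonneg _) (norm_nonneg _) ?_
  refine (form_mono hK _).trans ?_
  rw [form_solution hc hK]
  exact real_inner_le_norm _ _

lemma norm_solution_sub_le {K L : C(closure D.carrier, ℝ)} {b c : ℝ} (hb : 0 < b)
    (hK : ∀ x, b ≤ K x) (hc : 0 < c) (hL : ∀ x, c ≤ L x) (u : H10 D) :
    ‖solution u L - solution u K‖ ≤ ‖L - K‖ * ‖solution u K‖ / c := by
  refine le_div_of_mul_sq_le hc (norm_nonneg _) (by positivity) ((form_mono hL _).trans ?_)
  set w := solution u L - solution u K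
  have e1 := form_add_left L w (solution u K) w
  have e2 := form_add_field (L - K) K (solution u K) w
  rw [sub_add_cancel] at e1 e2
  rw [form_solution hc hL] at e1
  rw [form_solution hb hK] at e2
  have e3 := (neg_le_abs _).trans (abs_form_le (L - K) (solution u K) w)
  linarith

lemma continuousAt_solution {K : C(closure D.carrier, ℝ)} {c : ℝ} (hc : 0 < c)
    (hK : ∀ x, c ≤ K x) (u : H10 D) : ContinuousAt (solution u) K := by
  rw [ContinuousAt, tendsto_iff_norm_sub_tendsto_zero]
  refine squeeze_zero' (g := fun L => ‖L - K‖ * ‖solution u K‖ / (c / 2))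
    (Eventually.of_forall fun _ => norm_nonneg _) ?_ ?_
  · filter_upwards [Metric.ball_mem_nhds K (half_pos hc)] with L hL
    refine norm_solution_sub_le hc hK (half_pos hc) (fun x => ?_) u
    have h1 := (ContinuousMap.norm_coe_le_norm (L - K) x).trans (mem_ball_iff_norm.1 hL).le
    rw [Real.norm_eq_abs, abs_le, ContinuousMap.sub_apply] at h1
    linarith [hK x]
  · refine Continuous.tendsto' (by fun_prop) _ _ ?_
    simp

end Solution

/-! ### Measurability and integrability in `ω` -/

namespace DiffusionField

variable {Ω : Type*} [MeasurableSpace Ω] {P : Measure Ω}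

open EnergySpace

lemma le_max (κ : DiffusionField D P) (ω : Ω) (x : closure D.carrier) :
    κ.toFun ω x ≤ κ.max ω :=
  le_ciSup (isCompact_range (κ.toFun ω).continuous).bddAbove x

lemma aestronglyMeasurable_solution [NeZero d] (κ : DiffusionField D P) (u : H10 D) :
    AEStronglyMeasurable (fun ω => solution u (κ.toFun ω)) P := by
  -- `solution u` is continuous only at positive coefficients, so it is evaluated along simple
  -- functions that converge to `κ`.
  refine aestronglyMeasurable_of_tendsto_ae atTop
    (f := fun n ω => solution u (κ.stronglyMeasurable.approx n ω)) (fun n => ?_) ?_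
  · exact ((κ.stronglyMeasurable.approx n).map (solution u)).stronglyMeasurable.aestronglyMeasurable
  · filter_upwards [κ.min_pos] with ω h
    exact (continuousAt_solution h (κ.min_le ω) u).tendsto.comp
      (κ.stronglyMeasurable.tendsto_approx ω)

variable [IsProbabilityMeasure P]

lemma integrable_max (κ : DiffusionField D P) : Integrable κ.max P := by
  obtain ⟨p, hp, h, -⟩ := κ.exists_memLp
  exact h.integrable hp

lemma integral_inv_min_pos (κ : DiffusionField D P) : 0 < ∫ ω, 1 / κ.min ω ∂P := by
  have hpos : ∀ᵐ ω ∂P, 0 < 1 / κ.min ω := κ.min_pos.mono fun ω h => by positivity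
  refine (integral_nonneg_of_ae (hpos.mono fun _ h => h.le)).lt_of_ne fun h0 => ?_
  have h1 := (integral_eq_zero_iff_of_nonneg_ae (hpos.mono fun _ h => h.le)
    κ.integrable_inv_min).1 h0.symm
  obtain ⟨ω, h2, h3⟩ := (hpos.and h1).exists
  exact h2.ne' h3

/-! ### The mean and its right inverse -/

variable [NeZero d]

/-- The constant function `ω ↦ y`, as an element of the energy space. -/
def const (κ : DiffusionField D P) (y : H10 D) : κ.EnergySpace :=
  ⟨AEEqFun.const Ω y, by
    refine (κ.integrable_max.mul_const (‖y‖ ^ 2)).mono' (κ.aestronglyMeasurable_form _ _) ?_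
    filter_upwards [κ.pos, AEEqFun.coeFn_const (μ := P) Ω y] with ω h h1
    rw [h1, Function.const_apply, Real.norm_of_nonneg (form_self_nonneg (fun x => (h x).le) _)]
    exact form_le (κ.le_max ω) y⟩

lemma coeFn_val_const (κ : DiffusionField D P) (y : H10 D) :
    val (κ.const y) =ᵐ[P] fun _ => y :=
  AEEqFun.coeFn_const Ω y

lemma const_add (κ : DiffusionField D P) (y z : H10 D) :
    κ.const (y + z) = κ.const y + κ.const z := rfl

lemma const_smul (κ : DiffusionField D P) (c : ℝ) (y : H10 D) :
    κ.const (c • y) = c • κ.const y := rfl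

lemma integral_val_const (κ : DiffusionField D P) (y : H10 D) :
    ∫ ω, val (κ.const y) ω ∂P = y := by
  rw [integral_congr_ae (κ.coeFn_val_const y)]
  simp

lemma norm_const_le (κ : DiffusionField D P) (y : H10 D) :
    ‖κ.const y‖ ≤ √(∫ ω, κ.max ω ∂P) * ‖y‖ := by
  have h : ‖κ.const y‖ ^ 2 ≤ (∫ ω, κ.max ω ∂P) * ‖y‖ ^ 2 := by
    rw [norm_sq_eq, a, ← integral_mul_const]
    refine integral_mono_ae (EnergySpace.integrable_form _ _)
      (κ.integrable_max.mul_const _) ?_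
    filter_upwards [κ.coeFn_val_const y] with ω h
    rw [h]
    exact form_le (κ.le_max ω) y
  rw [← Real.sqrt_sq (norm_nonneg (κ.const y)), ← Real.sqrt_sq (norm_nonneg y),
    ← Real.sqrt_mul' _ (sq_nonneg _)]
  exact Real.sqrt_le_sqrt (by simpa using h)

/-- The Cauchy-Schwarz inequality for `‖v_ω‖ = κ_min(ω)^{-1/2} · κ_min(ω)^{1/2} ‖v_ω‖`. -/
lemma norm_integral_val_sq_le (κ : DiffusionField D P) (v : κ.EnergySpace) :
    ‖∫ ω, val v ω ∂P‖ ^ 2 ≤ (∫ ω, 1 / κ.min ω ∂P) * ‖v‖ ^ 2 := by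
  refine (pow_le_pow_left₀ (norm_nonneg _) (norm_integral_le_integral_norm _) 2).trans ?_
  -- The quadratic polynomial `t ↦ E[1/κ_min] t² - 2 E[‖v_ω‖] t + ‖v‖²` is nonnegative.
  have key : ∀ t : ℝ, 0 ≤ (∫ ω, 1 / κ.min ω ∂P) * (t * t) +
      (-(2 * ∫ ω, ‖val v ω‖ ∂P)) * t + ‖v‖ ^ 2 := by
    intro t
    have hle : ∫ ω, 2 * t * ‖val v ω‖ ∂P ≤
        ∫ ω, t * t * (1 / κ.min ω) + form (κ.toFun ω) (val v ω) (val v ω) ∂P := by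
      refine integral_mono_ae ((integrable v).norm.const_mul _)
        ((κ.integrable_inv_min.const_mul _).add (EnergySpace.integrable_form v v)) ?_
      filter_upwards [κ.min_pos] with ω h
      have h1 := form_mono (κ.min_le ω) (val v ω)
      have h2 : t * t * (1 / κ.min ω) + κ.min ω * ‖val v ω‖ ^ 2 - 2 * t * ‖val v ω‖ =
          (t - κ.min ω * ‖val v ω‖) ^ 2 / κ.min ω := by
        field_simp
        ring
      have h3 : 0 ≤ (t - κ.min ω * ‖val v ω‖) ^ 2 / κ.min ω := by positivity
      linarith
    rw [integral_const_mul, integral_add (κ.integrable_inv_min.const_mul _)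
      (EnergySpace.integrable_form v v), integral_const_mul] at hle
    rw [norm_sq_eq, a]
    linarith
  have h := discrim_le_zero key
  rw [discrim] at h
  linarith

lemma norm_integral_val_le (κ : DiffusionField D P) (v : κ.EnergySpace) :
    ‖∫ ω, val v ω ∂P‖ ≤ √(∫ ω, 1 / κ.min ω ∂P) * ‖v‖ := by
  rw [← Real.sqrt_sq (norm_nonneg (∫ ω, val v ω ∂P)), ← Real.sqrt_sq (norm_nonneg v),
    ← Real.sqrt_mul' _ (sq_nonneg _)]
  exact Real.sqrt_le_sqrt (by simpa using κ.norm_integral_val_sq_le v)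

/-! ### The operator `𝓘` and the polar space of `G` -/

lemma opI_apply_eq (κ : DiffusionField D P) (f : StrongDual ℝ (H10 D)) (v : κ.EnergySpace) :
    κ.opI f v = f (∫ ω, val v ω ∂P) :=
  f.integral_comp_comm (integrable v)

lemma opI_injective (κ : DiffusionField D P) : Function.Injective κ.opI := fun f g h =>
  ContinuousLinearMap.ext fun y => by
    have h1 := DFunLike.congr_fun h (κ.const y)
    rwa [opI_apply_eq, opI_apply_eq, integral_val_const] at h1

lemma sub_const_integral_mem_G (κ : DiffusionField D P) (v : κ.EnergySpace) :
    v - κ.const (∫ ω, val v ω ∂P) ∈ κ.G := by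
  have h := integral_val_add (v - κ.const (∫ ω, val v ω ∂P)) (κ.const (∫ ω, val v ω ∂P))
  rw [sub_add_cancel, integral_val_const] at h
  exact right_eq_add.1 h

lemma bijOn_opI (κ : DiffusionField D P) : BijOn κ.opI univ κ.G0 := by
  refine ⟨fun f _ v hv => ?_, κ.opI_injective.injOn, fun F hF => ?_⟩
  · rw [opI_apply_eq, show ∫ ω, val v ω ∂P = 0 from hv, map_zero]
  · let f : StrongDual ℝ (H10 D) := LinearMap.mkContinuous
      { toFun := fun y => F (κ.const y)
        map_add' := fun y z => by rw [const_add, map_add]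
        map_smul' := fun c y => by rw [const_smul, map_smul, RingHom.id_apply] }
      (‖F‖ * √(∫ ω, κ.max ω ∂P)) fun y => by
        rw [mul_assoc]
        exact (F.le_opNorm _).trans
          (mul_le_mul_of_nonneg_left (κ.norm_const_le y) (norm_nonneg _))
    refine ⟨f, mem_univ _, ContinuousLinearMap.ext fun v => ?_⟩
    have h := hF _ (κ.sub_const_integral_mem_G v)
    rw [map_sub, sub_eq_zero] at h
    rw [opI_apply_eq, h]
    rfl

lemma opA_mem_G0 (κ : DiffusionField D P) (y : κ.Gperp) : κ.opA y ∈ κ.G0 :=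
  (κ.mem_Gperp_iff y).1 y.2

/-! ### The map `𝓔⁻¹` -/

lemma opI_riesz_Einv (κ : DiffusionField D P) (y : κ.Gperp) :
    κ.opI (riesz D (κ.Einv y)) = κ.opA y := by
  obtain ⟨f, -, hf⟩ := κ.bijOn_opI.surjOn (κ.opA_mem_G0 y)
  rw [Einv, Equiv.apply_symm_apply]
  exact Function.invFun_eq ⟨f, hf⟩

lemma Einv_eq_iff (κ : DiffusionField D P) (y : κ.Gperp) (u : H10 D) :
    κ.Einv y = u ↔ ∀ v : κ.EnergySpace, inner ℝ (y : κ.EnergySpace) v =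
      inner ℝ u (∫ ω, val v ω ∂P) := by
  have h : κ.Einv y = u ↔ κ.opA y = κ.opI (riesz D u) := by
    rw [← opI_riesz_Einv, κ.opI_injective.eq_iff, (riesz D).injective.eq_iff]
  rw [h, ContinuousLinearMap.ext_iff]
  refine forall_congr' fun v => ?_
  rw [opI_apply_eq]
  rfl

lemma inner_Einv (κ : DiffusionField D P) (y : κ.Gperp) (v : κ.EnergySpace) :
    inner ℝ (κ.Einv y) (∫ ω, val v ω ∂P) = inner ℝ (y : κ.EnergySpace) v :=
  ((κ.Einv_eq_iff y _).1 rfl v).symm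

lemma Einv_sub (κ : DiffusionField D P) (y z : κ.Gperp) :
    κ.Einv (y - z) = κ.Einv y - κ.Einv z := by
  rw [Einv_eq_iff]
  intro v
  rw [Submodule.coe_sub, inner_sub_left, inner_sub_left, inner_Einv, inner_Einv]

lemma norm_Einv_le (κ : DiffusionField D P) (y : κ.Gperp) :
    ‖κ.Einv y‖ ≤ √(∫ ω, κ.max ω ∂P) * ‖y‖ := by
  have h : ‖κ.Einv y‖ ^ 2 ≤ (√(∫ ω, κ.max ω ∂P) * ‖y‖) * ‖κ.Einv y‖ := by
    have h1 := κ.inner_Einv y (κ.const (κ.Einv y))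
    rw [integral_val_const, real_inner_self_eq_norm_sq] at h1
    calc ‖κ.Einv y‖ ^ 2 ≤ ‖y‖ * ‖κ.const (κ.Einv y)‖ := h1.trans_le (real_inner_le_norm _ _)
      _ ≤ ‖y‖ * (√(∫ ω, κ.max ω ∂P) * ‖κ.Einv y‖) := by gcongr; exact κ.norm_const_le _
      _ = _ := by ring
  simpa using le_div_of_mul_sq_le one_pos (norm_nonneg _) (by positivity)
    ((one_mul (‖κ.Einv y‖ ^ 2)).trans_le h)

lemma norm_le_Einv (κ : DiffusionField D P) (y : κ.Gperp) :
    ‖y‖ ≤ √(∫ ω, 1 / κ.min ω ∂P) * ‖κ.Einv y‖ := by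
  have h : ‖y‖ ^ 2 ≤ (√(∫ ω, 1 / κ.min ω ∂P) * ‖κ.Einv y‖) * ‖y‖ := by
    have h1 := κ.inner_Einv y y
    rw [real_inner_self_eq_norm_sq] at h1
    calc ‖y‖ ^ 2 ≤ ‖κ.Einv y‖ * ‖∫ ω, val (y : κ.EnergySpace) ω ∂P‖ :=
          h1.symm.trans_le (real_inner_le_norm _ _)
      _ ≤ ‖κ.Einv y‖ * (√(∫ ω, 1 / κ.min ω ∂P) * ‖y‖) := by
          gcongr; exact κ.norm_integral_val_le _
      _ = _ := by ring
  simpa using le_div_of_mul_sq_le one_pos (norm_nonneg _) (by positivity)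
    ((one_mul (‖y‖ ^ 2)).trans_le h)

/-- The pathwise solution `ω ↦ y_ω`, as an element of the energy space. -/
def energySolution (κ : DiffusionField D P) (u : H10 D) : κ.EnergySpace :=
  ⟨AEEqFun.mk _ (κ.aestronglyMeasurable_solution u), by
    refine (κ.integrable_inv_min.const_mul (‖u‖ ^ 2)).mono' (κ.aestronglyMeasurable_form _ _) ?_
    filter_upwards [κ.min_pos, AEEqFun.coeFn_mk _ (κ.aestronglyMeasurable_solution u)] with ω h h1
    rw [h1, form_solution h (κ.min_le ω)]
    calc ‖inner ℝ u (solution u (κ.toFun ω))‖ ≤ ‖u‖ * ‖solution u (κ.toFun ω)‖ :=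
          norm_inner_le_norm _ _
      _ ≤ ‖u‖ * (‖u‖ / κ.min ω) := by gcongr; exact norm_solution_le h (κ.min_le ω) u
      _ = _ := by ring⟩

lemma inner_energySolution (κ : DiffusionField D P) (u : H10 D) (v : κ.EnergySpace) :
    inner ℝ (κ.energySolution u) v = inner ℝ u (∫ ω, val v ω ∂P) := by
  rw [← integral_inner (integrable v) u, EnergySpace.inner_eq, a]
  refine integral_congr_ae ?_
  filter_upwards [κ.min_pos, AEEqFun.coeFn_mk _ (κ.aestronglyMeasurable_solution u)] with ω h h1
  change form (κ.toFun ω) ((AEEqFun.mk _ (κ.aestronglyMeasurable_solution u)) ω) (val v ω) = _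
  rw [h1, form_solution h (κ.min_le ω)]

lemma Einv_surjective (κ : DiffusionField D P) : Function.Surjective κ.Einv := by
  intro u
  have hmem : κ.energySolution u ∈ κ.Gperp := by
    rw [mem_Gperp_iff]
    intro v hv
    rw [← EnergySpace.inner_eq, inner_energySolution, show ∫ ω, val v ω ∂P = 0 from hv,
      inner_zero_right]
  exact ⟨⟨_, hmem⟩, (κ.Einv_eq_iff _ _).2 (κ.inner_energySolution u)⟩

lemma isHomeomorph_Einv (κ : DiffusionField D P) : IsHomeomorph κ.Einv := by
  have hL : LipschitzWith (Real.toNNReal √(∫ ω, κ.max ω ∂P)) κ.Einv :=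
    LipschitzWith.of_dist_le_mul fun y z => by
      rw [dist_eq_norm, dist_eq_norm, ← Einv_sub, Real.coe_toNNReal _ (Real.sqrt_nonneg _)]
      exact κ.norm_Einv_le _
  have hA : AntilipschitzWith (Real.toNNReal √(∫ ω, 1 / κ.min ω ∂P)) κ.Einv :=
    AntilipschitzWith.of_le_mul_dist fun y z => by
      rw [dist_eq_norm, dist_eq_norm, ← Einv_sub, Real.coe_toNNReal _ (Real.sqrt_nonneg _)]
      exact κ.norm_le_Einv _
  exact isHomeomorph_iff_isEmbedding_surjective.2
    ⟨(hA.isUniformEmbedding hL.uniformContinuous).isEmbedding, κ.Einv_surjective⟩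

end DiffusionField

end RobustOCP

end

theorem theorem6p2 {d : ℕ} [NeZero d] (D : RobustOCP.Domain d) {Ω : Type*} [MeasurableSpace Ω]
    (P : MeasureTheory.Measure Ω) [MeasureTheory.IsProbabilityMeasure P]
    (κ : RobustOCP.DiffusionField D P) :
    -- the map is well defined: `𝓘 : Y⋆ → G⁰` is bijective and `𝓐` maps `G^⊥` into `G⁰`
    (Set.BijOn κ.opI Set.univ κ.G0 ∧ ∀ y : κ.Gperp, κ.opA y ∈ κ.G0) ∧
    IsHomeomorph κ.Einv ∧
    ∀ y : κ.Gperp,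
      1 / √(∫ ω, 1 / κ.min ω ∂P) * ‖y‖ ≤ ‖κ.Einv y‖ ∧
      ‖κ.Einv y‖ ≤ √(∫ ω, κ.max ω ∂P) * ‖y‖ := by
  refine ⟨⟨κ.bijOn_opI, κ.opA_mem_G0⟩, κ.isHomeomorph_Einv, fun y => ⟨?_, κ.norm_Einv_le y⟩⟩
  rw [one_div_mul_eq_div, div_le_iff₀' (Real.sqrt_pos.2 κ.integral_inv_min_pos)]
  exact κ.norm_le_Einv y
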